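/- Let $\lambda,\mu,\sigma,\rho,a>0$, $y_0>0$ and $s_0\in\{-1,+1\}$. On a complete probability space, let $(\xi(t))_{t\ge 0}$ be a right-continuous continuous-time Markov chain with state space $\{-1,+1\}$, with infinitesimal generator $\begin{pmatrix}-\lambda&\lambda\\ \lambda&-\lambda\end{pmatrix}$ and with $\xi(0)=s_0$ almost surely. Put $$Y_t=y_0\exp\Bigl(\mu t+\sigma\int_0^t\xi(u)\,du\Bigr),\qquad X_t=e^{-\rho t}(Y_t-a)\quad(t\ge 0),\qquad X_\infty=0,$$ and let $g(y_0,s_0)=\sup_\tau E(X_\tau)$, where the supremum is over all $[0,\infty]$-valued stopping times $\tau$ of the completed natural filtration of $\xi$, and where the expectations are taken in $(-\infty,+\infty]$. Then: 1. If $\rho>\mu-\lambda+\sqrt{\sigma^2+\lambda^2}$, then $g(y_0,s_0)<\infty$. 2. $\rho>\mu-\lambda+\sqrt{\sigma^2+\lambda^2}$ if and only if $E\bigl(\sup_{t\ge0}|X_t|\bigr)<\infty$. 3. $\rho<\mu-\lambda+\sqrt{\sigma^2+\lambda^2}$ if and only if $\sup_{t\ge0}E(X_t)=+\infty$. -/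

import Mathlib

open MeasureTheory Filter Topology
open scoped NNReal ENNReal

noncomputable section

namespace Telegraph

/-- The infinitesimal generator of the symmetric two-state chain with switching rate `lam`.
The state space `{-1, +1}` is `ℤˣ`. -/
def generator (lam : ℝ) : Matrix ℤˣ ℤˣ ℝ :=
  Matrix.of fun r s => if r = s then -lam else lam

/-- The transition matrices `P(t) = exp(tG)`. -/
def transition (lam : ℝ) (t : ℝ≥0) : Matrix ℤˣ ℤˣ ℝ :=
  NormedSpace.exp ((t : ℝ) • generator lam)

section Defs

variable {Ω : Type*}

/-- The σ-algebra generated by `ξ u`, `u ≤ t`. -/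
@[reducible] def past (ξ : ℝ≥0 → Ω → ℤˣ) (t : ℝ≥0) : MeasurableSpace Ω :=
  ⨆ u : ℝ≥0, ⨆ _ : u ≤ t, MeasurableSpace.comap (ξ u) inferInstance

/-- Under `P`, the process `ξ` is a right-continuous Markov chain on `{-1, +1}` with generator
`generator lam`, started at `s₀`. -/
structure IsChain [MeasurableSpace Ω] (P : Measure Ω) (lam : ℝ) (s₀ : ℤˣ)
    (ξ : ℝ≥0 → Ω → ℤˣ) : Prop where
  measurable : ∀ t, Measurable (ξ t)
  initial : ∀ᵐ ω ∂P, ξ 0 ω = s₀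
  right_continuous : ∀ ω t, ∀ᶠ u in 𝓝[≥] t, ξ u ω = ξ t ω
  markov : ∀ (t h : ℝ≥0) (s : ℤˣ),
    P[Set.indicator {ω | ξ (t + h) ω = s} (fun _ => (1 : ℝ)) | past ξ t]
      =ᵐ[P] fun ω => transition lam h (ξ t ω) s

theorem past_mono (ξ : ℝ≥0 → Ω → ℤˣ) {s t : ℝ≥0} (h : s ≤ t) : past ξ s ≤ past ξ t :=
  iSup₂_le fun u hu =>
    le_iSup₂ (f := fun (u : ℝ≥0) (_ : u ≤ t) => MeasurableSpace.comap (ξ u) inferInstance)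
      u (hu.trans h)

theorem past_le [m : MeasurableSpace Ω] {ξ : ℝ≥0 → Ω → ℤˣ} (hξ : ∀ t, Measurable (ξ t))
    (t : ℝ≥0) : past ξ t ≤ m :=
  iSup₂_le fun u _ => (hξ u).comap_le

/-- The natural filtration of `ξ`, completed with the `P`-null sets. -/
def completedFiltration [m : MeasurableSpace Ω] (P : Measure Ω) [P.IsComplete]
    (ξ : ℝ≥0 → Ω → ℤˣ) (hξ : ∀ t, Measurable (ξ t)) : Filtration ℝ≥0 m where
  seq t := eventuallyMeasurableSpace (past ξ t) (ae P)
  mono' := by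
    rintro s t h A ⟨B, hB, hAB⟩
    exact ⟨B, past_mono ξ h B hB, hAB⟩
  le' := by
    rintro t A ⟨B, hB, hAB⟩
    exact NullMeasurableSet.measurable_of_complete ⟨B, past_le hξ t B hB, hAB⟩

/-- The price `Y_t = y₀ exp(μ t + σ ∫₀ᵗ ξ(u) du)`. -/
def price (mu sig y₀ : ℝ) (ξ : ℝ≥0 → Ω → ℤˣ) (t : ℝ≥0) (ω : Ω) : ℝ :=
  y₀ * Real.exp (mu * t + sig * ∫ u in (0 : ℝ)..t, (((ξ u.toNNReal ω : ℤˣ) : ℤ) : ℝ))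

/-- The reward `X_t = exp(-ρ t) (Y_t - a)`. -/
def reward (mu sig rho a y₀ : ℝ) (ξ : ℝ≥0 → Ω → ℤˣ) (t : ℝ≥0) (ω : Ω) : ℝ :=
  Real.exp (-rho * t) * (price mu sig y₀ ξ t ω - a)

/-- The random variable `X_τ`, where `X_∞ = 0`. -/
def valueAt (X : ℝ≥0 → Ω → ℝ) (τ : Ω → WithTop ℝ≥0) (ω : Ω) : ℝ :=
  match τ ω with
  | none => 0
  | some t => X t ω

/-- The expectation `E Z = E Z⁺ - E Z⁻` as an extended real number (for `Z` whose negative part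
is integrable). -/
def expectation [MeasurableSpace Ω] (P : Measure Ω) (Z : Ω → ℝ) : EReal :=
  ((∫⁻ ω, ENNReal.ofReal (Z ω) ∂P : ℝ≥0∞) : EReal)
    - ((∫⁻ ω, ENNReal.ofReal (-Z ω) ∂P : ℝ≥0∞) : EReal)

/-- The value `sup_τ E X_τ`, over all stopping times `τ` (with values in `[0, ∞]`) of a
filtration. -/
def value [m : MeasurableSpace Ω] (P : Measure Ω) (ℱ : Filtration ℝ≥0 m)
    (X : ℝ≥0 → Ω → ℝ) : EReal :=
  ⨆ τ : {τ : Ω → WithTop ℝ≥0 // IsStoppingTime ℱ τ}, expectation P (valueAt X τ.1)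

end Defs

end Telegraph

end

/-! Everything rests on the exponential moments of the occupation integral `A_t = ∫₀ᵗ ξ`. Tilting
the generator to `G + c·diag(1, -1)` gives a matrix with top eigenvalue `√(c² + λ²) - λ` and a
positive eigenvector `v`. Hence `E[exp(c A_t) v(ξ_t)]` equals `exp(growth · t) v(s₀)`
(`IsChain.integral_exp_mul_eigenvector`), proved by a grid version of Feynman–Kac. Since `v` takes
two positive values, `E[exp(c A_t)]` is of exact order `exp(growth · t)`, and with `c = σ` the
discounted price `D_t = e^{-ρt} Y_t` has mean of exact order `exp((μ + growth - ρ)t)`.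

Above the critical rate these means are summable over the integers. On unit intervals `D` grows by
at most a constant factor, so `sup |X_t|` is integrable, and it dominates every `X_τ`. Below it `E
X_t` is unbounded. At or above it `E X_t` stays bounded.

At the critical rate `E D_n` stays away from `0`. Yet `D_n → 0` almost surely, because `√D_n` has
exponentially decaying mean by strict convexity of the growth rate (`growth_half_lt`). An integrable
supremum would contradict dominated convergence. -/

namespace Telegraph

/-! ### Riemann sums of right-continuous functions -/

/-- Grid points approximate a nonnegative real from the right. -/
theorem tendsto_floor_succ_div {x : ℝ} (hx0 : 0 ≤ x) :
    Tendsto (fun n : ℕ => ((⌊(n : ℝ) * x⌋₊ : ℝ) + 1) / n) atTop (𝓝[≥] x) := by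
  refine tendsto_nhdsWithin_iff.2 ⟨?_, ?_⟩
  · have h1 : Tendsto (fun n : ℕ => x + 1 / (n : ℝ)) atTop (𝓝 x) := by
      simpa using (tendsto_const_nhds (x := x)).add
        (tendsto_one_div_atTop_nhds_zero_nat (𝕜 := ℝ))
    refine tendsto_of_tendsto_of_tendsto_of_le_of_le' tendsto_const_nhds h1 ?_ ?_
    · filter_upwards [eventually_gt_atTop 0] with n hn
      have hn' : (0 : ℝ) < n := by exact_mod_cast hn
      rw [le_div_iff₀ hn']
      linarith [Nat.lt_floor_add_one ((n : ℝ) * x)]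
    · filter_upwards [eventually_gt_atTop 0] with n hn
      have hn' : (0 : ℝ) < n := by exact_mod_cast hn
      have := Nat.floor_le (mul_nonneg hn'.le hx0)
      rw [div_le_iff₀ hn', add_mul, one_div_mul_cancel hn'.ne']
      linarith
  · filter_upwards [eventually_gt_atTop 0] with n hn
    have hn' : (0 : ℝ) < n := by exact_mod_cast hn
    rw [Set.mem_Ici, le_div_iff₀ hn']
    linarith [Nat.lt_floor_add_one ((n : ℝ) * x)]

/-- A pointwise limit of step functions sampled at grid points to the right. The truncation is there
because right-continuity is only assumed on `[0, ∞)`. -/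
theorem measurable_comp_max_of_rightContinuous {f : ℝ → ℝ}
    (hf : ∀ x, 0 ≤ x → Tendsto f (𝓝[≥] x) (𝓝 (f x))) : Measurable fun x => f (max x 0) := by
  refine measurable_of_tendsto_metrizable
    (f := fun (n : ℕ) (x : ℝ) => f ((⌊(n : ℝ) * max x 0⌋₊ + 1) / n)) (fun n => ?_)
    (tendsto_pi_nhds.2 fun x => (hf _ (le_max_right _ _)).comp
      (tendsto_floor_succ_div (le_max_right _ _)))
  exact (measurable_of_countable fun k : ℕ => f (((k : ℝ) + 1) / n)).comp
    (Nat.measurable_floor.comp (measurable_const.mul (measurable_id.max measurable_const)))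

/-- Right-endpoint Riemann sums of a bounded right-continuous function converge to its integral. -/
theorem tendsto_riemannSum_of_rightContinuous {f : ℝ → ℝ} {C : ℝ} (hC : ∀ x, |f x| ≤ C)
    (hf : ∀ x, 0 ≤ x → Tendsto f (𝓝[≥] x) (𝓝 (f x))) :
    Tendsto (fun n : ℕ => ∑ k ∈ Finset.range n, (1 / (n : ℝ)) * f (((k : ℝ) + 1) / n)) atTop
      (𝓝 (∫ x in (0 : ℝ)..1, f x)) := by
  have hlim : Tendsto (fun n : ℕ => ∫ x in (0 : ℝ)..1, f ((⌊(n : ℝ) * x⌋₊ + 1) / n)) atTop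
      (𝓝 (∫ x in (0 : ℝ)..1, f x)) := by
    refine intervalIntegral.tendsto_integral_filter_of_dominated_convergence (fun _ => C)
      (Eventually.of_forall fun n => ?_) (Eventually.of_forall fun n => ?_) (by simp) ?_
    · have h : Measurable fun x : ℝ => f ((⌊(n : ℝ) * x⌋₊ + 1) / n) :=
        (measurable_of_countable fun k : ℕ => f (((k : ℝ) + 1) / n)).comp
          (Nat.measurable_floor.comp (measurable_const.mul measurable_id))
      exact h.aestronglyMeasurable
    · exact Eventually.of_forall fun x _ => hC _
    · refine Eventually.of_forall fun x hx => ?_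
      have hx0 : 0 ≤ x := by
        rw [Set.uIoc_of_le zero_le_one] at hx
        exact hx.1.le
      exact (hf x hx0).comp (tendsto_floor_succ_div hx0)
  refine hlim.congr' ?_
  filter_upwards [eventually_gt_atTop 0] with n hn
  have hn' : (0 : ℝ) < n := by exact_mod_cast hn
  -- The floor is constant on each open cell; the endpoints are null for the integral.
  have key : ∀ k : ℕ, Set.EqOn (fun x : ℝ => f ((⌊(n : ℝ) * x⌋₊ + 1) / n))
      (fun _ => f (((k : ℝ) + 1) / n)) (Set.Ioo ((k : ℝ) / n) (((k + 1 : ℕ) : ℝ) / n)) := by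
    intro k x hx
    have h1 := (div_lt_iff₀ hn').1 hx.1
    have h2 := (lt_div_iff₀ hn').1 hx.2
    push_cast at h2
    have : ⌊(n : ℝ) * x⌋₊ = k := by
      rw [Nat.floor_eq_iff (by nlinarith [(Nat.cast_nonneg k : (0 : ℝ) ≤ k)])]
      constructor <;> linarith
    simp only [this]
  have hle : ∀ k : ℕ, (k : ℝ) / n ≤ ((k + 1 : ℕ) : ℝ) / n := by
    intro k
    gcongr
    simp
  have hint : ∀ k : ℕ, IntervalIntegrable (fun x : ℝ => f ((⌊(n : ℝ) * x⌋₊ + 1) / n)) volume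
      ((k : ℝ) / n) (((k + 1 : ℕ) : ℝ) / n) := by
    intro k
    rw [intervalIntegrable_iff_integrableOn_Ioo_of_le (hle k)]
    exact (integrableOn_const (by simp)).congr_fun (key k).symm measurableSet_Ioo
  have hsum := intervalIntegral.sum_integral_adjacent_intervals
    (a := fun k : ℕ => (k : ℝ) / n) (n := n) (fun k _ => hint k)
  simp only [Nat.cast_zero, zero_div, div_self hn'.ne'] at hsum
  rw [← hsum]
  refine Finset.sum_congr rfl fun k _ => ?_
  rw [intervalIntegral.integral_of_le (hle k), integral_Ioc_eq_integral_Ioo,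
    setIntegral_congr_fun measurableSet_Ioo (key k)]
  simp only [setIntegral_const, smul_eq_mul, measureReal_def, Real.volume_Ioo]
  rw [ENNReal.toReal_ofReal (sub_nonneg.2 (hle k))]
  congr 1
  push_cast
  ring

/-! ### Paths and their occupation integral -/

section Path

variable {Ω : Type*}

/-- The integral `∫₀ᵗ ξ(u) du`. -/
noncomputable def occupation (ξ : ℝ≥0 → Ω → ℤˣ) (t : ℝ≥0) (ω : Ω) : ℝ :=
  ∫ u in (0 : ℝ)..t, (((ξ u.toNNReal ω : ℤˣ) : ℤ) : ℝ)

theorem abs_unit_cast (s : ℤˣ) : |((s : ℤ) : ℝ)| = 1 := by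
  rcases Int.units_eq_one_or s with rfl | rfl <;> simp

/-- The right-endpoint Riemann sum with step `h` of the path, over `n` steps. -/
noncomputable def gridSum (ξ : ℝ≥0 → Ω → ℤˣ) (h : ℝ≥0) (n : ℕ) (ω : Ω) : ℝ :=
  ∑ k ∈ Finset.range n, (h : ℝ) * (((ξ ((k + 1 : ℕ) * h) ω : ℤˣ) : ℤ) : ℝ)

theorem abs_gridSum_le (ξ : ℝ≥0 → Ω → ℤˣ) (h : ℝ≥0) (n : ℕ) (ω : Ω) :
    |gridSum ξ h n ω| ≤ n * h := by
  refine (Finset.abs_sum_le_sum_abs _ _).trans ?_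
  simp [abs_mul, abs_unit_cast]

theorem tendsto_path_right {ξ : ℝ≥0 → Ω → ℤˣ} {ω : Ω}
    (hξ : ∀ t, ∀ᶠ u in 𝓝[≥] t, ξ u ω = ξ t ω) {T : ℝ} (hT : 0 ≤ T) (x : ℝ) :
    Tendsto (fun x : ℝ => (((ξ (T * x).toNNReal ω : ℤˣ) : ℤ) : ℝ)) (𝓝[≥] x)
      (𝓝 (((ξ (T * x).toNNReal ω : ℤˣ) : ℤ) : ℝ)) := by
  refine Tendsto.congr' ?_ tendsto_const_nhds
  have : Tendsto (fun x : ℝ => (T * x).toNNReal) (𝓝[≥] x) (𝓝[≥] (T * x).toNNReal) := by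
    refine tendsto_nhdsWithin_iff.2 ⟨?_, ?_⟩
    · have : Continuous fun x : ℝ => (T * x).toNNReal := by fun_prop
      exact this.continuousAt.tendsto.mono_left nhdsWithin_le_nhds
    · filter_upwards [self_mem_nhdsWithin] with y hy
      exact Real.toNNReal_mono (mul_le_mul_of_nonneg_left hy hT)
  filter_upwards [this.eventually (hξ _)] with y hy
  rw [hy]

theorem tendsto_gridSum {ξ : ℝ≥0 → Ω → ℤˣ} {ω : Ω}
    (hξ : ∀ t, ∀ᶠ u in 𝓝[≥] t, ξ u ω = ξ t ω) (T : ℝ≥0) :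
    Tendsto (fun n : ℕ => gridSum ξ (T / n) n ω) atTop (𝓝 (occupation ξ T ω)) := by
  have h := tendsto_riemannSum_of_rightContinuous
    (f := fun x => (((ξ ((T : ℝ) * x).toNNReal ω : ℤˣ) : ℤ) : ℝ)) (C := 1)
    (fun x => (abs_unit_cast _).le) (fun x _ => tendsto_path_right hξ T.2 x)
  -- Multiplying by `T` rather than dividing makes the substitution valid for `T = 0` too.
  have h2 := h.const_mul (T : ℝ)
  rw [intervalIntegral.mul_integral_comp_mul_left (c := (T : ℝ))
    (f := fun x => (((ξ x.toNNReal ω : ℤˣ) : ℤ) : ℝ)), mul_zero, mul_one] at h2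
  refine h2.congr fun n => ?_
  rw [gridSum, Finset.mul_sum]
  refine Finset.sum_congr rfl fun k _ => ?_
  have : ((T : ℝ) * (((k : ℝ) + 1) / n)).toNNReal = ((k + 1 : ℕ) : ℝ≥0) * (T / n) := by
    rw [← NNReal.coe_inj, Real.coe_toNNReal _ (by positivity)]
    push_cast
    ring
  rw [this]
  push_cast
  ring

theorem abs_occupation_le (ξ : ℝ≥0 → Ω → ℤˣ) (t : ℝ≥0) (ω : Ω) :
    |occupation ξ t ω| ≤ t := by
  rw [occupation, ← Real.norm_eq_abs]
  refine (intervalIntegral.norm_integral_le_of_norm_le_const (C := 1) fun x _ => ?_).trans ?_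
  · rw [Real.norm_eq_abs, abs_unit_cast]
  · simp

theorem occupation_le_add {ξ : ℝ≥0 → Ω → ℤˣ} {ω : Ω}
    (hξ : ∀ t, ∀ᶠ u in 𝓝[≥] t, ξ u ω = ξ t ω) {s t : ℝ≥0} (hst : s ≤ t) :
    occupation ξ t ω ≤ occupation ξ s ω + (t - s) := by
  have hmeas : Measurable fun x : ℝ => (((ξ x.toNNReal ω : ℤˣ) : ℤ) : ℝ) := by
    have := measurable_comp_max_of_rightContinuous
      (f := fun x : ℝ => (((ξ (1 * x).toNNReal ω : ℤˣ) : ℤ) : ℝ))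
      (fun x _ => tendsto_path_right hξ zero_le_one x)
    refine (funext fun x => ?_ : (fun x : ℝ => (((ξ x.toNNReal ω : ℤˣ) : ℤ) : ℝ)) = _) ▸ this
    have : (max x 0).toNNReal = x.toNNReal := by
      rcases le_total x 0 with h | h <;> simp [h, Real.toNNReal_of_nonpos]
    rw [one_mul, this]
  have hint : ∀ p q : ℝ,
      IntervalIntegrable (fun x : ℝ => (((ξ x.toNNReal ω : ℤˣ) : ℤ) : ℝ)) volume p q := by
    intro p q
    refine (intervalIntegrable_const (c := (1 : ℝ))).mono_fun hmeas.aestronglyMeasurable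
      (Eventually.of_forall fun x => ?_)
    simp [abs_unit_cast]
  have hst' : (s : ℝ) ≤ t := by exact_mod_cast hst
  rw [occupation, occupation, ← intervalIntegral.integral_add_adjacent_intervals
    (hint 0 s) (hint s t)]
  gcongr
  refine (le_abs_self _).trans ?_
  rw [← Real.norm_eq_abs]
  refine (intervalIntegral.norm_integral_le_of_norm_le_const (C := 1) fun x _ => ?_).trans ?_
  · rw [Real.norm_eq_abs, abs_unit_cast]
  · rw [abs_of_nonneg (sub_nonneg.2 hst'), one_mul]

end Path

/-! ### The tilted generator and its one-step growth -/

/-- The top eigenvalue of `generator lam + c • diag(1, -1)`. -/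
noncomputable def growth (lam c : ℝ) : ℝ := Real.sqrt (c ^ 2 + lam ^ 2) - lam

/-- An eigenvector of `generator lam + c • diag(1, -1)` for the eigenvalue `growth lam c`. -/
noncomputable def eigenvector (lam c : ℝ) (s : ℤˣ) : ℝ :=
  if s = 1 then lam else Real.sqrt (c ^ 2 + lam ^ 2) - c

theorem eigenvector_pos {lam : ℝ} (hlam : 0 < lam) (c : ℝ) (s : ℤˣ) :
    0 < eigenvector lam c s := by
  unfold eigenvector
  split_ifs
  · exact hlam
  · rw [sub_pos]
    apply Real.lt_sqrt_of_sq_lt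
    nlinarith

theorem sum_generator_mul_eigenvector (lam c : ℝ) (s : ℤˣ) :
    ∑ s', generator lam s s' * eigenvector lam c s' + c * ((s : ℤ) : ℝ) * eigenvector lam c s
      = growth lam c * eigenvector lam c s := by
  have hr : Real.sqrt (c ^ 2 + lam ^ 2) ^ 2 = c ^ 2 + lam ^ 2 := Real.sq_sqrt (by positivity)
  have h1 : (-1 : ℤˣ) ≠ 1 := by decide
  rw [UnitsInt.univ, Finset.sum_pair h1.symm]
  rcases Int.units_eq_one_or s with rfl | rfl
  · simp [generator, eigenvector, growth, h1]
    ring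
  · simp [generator, eigenvector, growth, h1]
    linear_combination -hr

/-- The mean of `exp (c x s') * eigenvector s'` after time `x`, relative to the eigenvector at the
starting state `s`. -/
noncomputable def stepRatio (lam c : ℝ) (s : ℤˣ) (x : ℝ) : ℝ :=
  (∑ s', NormedSpace.exp (x • generator lam) s s' *
    (Real.exp (c * (x * ((s' : ℤ) : ℝ))) * eigenvector lam c s')) / eigenvector lam c s

theorem stepRatio_zero {lam : ℝ} (hlam : 0 < lam) (c : ℝ) (s : ℤˣ) :
    stepRatio lam c s 0 = 1 := by
  simp [-UnitsInt.univ, stepRatio, Matrix.one_apply, (eigenvector_pos hlam c s).ne']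

-- The norm is auxiliary: it lets the matrix exponential be differentiated, and taking an entry is
-- continuous and linear.
attribute [local instance] Matrix.linftyOpNormedRing Matrix.linftyOpNormedAlgebra in
theorem hasDerivAt_exp_smul_apply (A : Matrix ℤˣ ℤˣ ℝ) (s s' : ℤˣ) :
    HasDerivAt (fun x : ℝ => NormedSpace.exp (x • A) s s') (A s s') 0 := by
  have h := hasDerivAt_exp_smul_const (𝕂 := ℝ) A 0
  rw [zero_smul, NormedSpace.exp_zero, one_mul] at h
  let e : Matrix ℤˣ ℤˣ ℝ →L[ℝ] ℝ := (Matrix.entryLinearMap ℝ ℝ s s').toContinuousLinearMap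
  exact e.hasFDerivAt.comp_hasDerivAt (0 : ℝ) h

/-- The product rule at `0` yields the tilted generator applied to its eigenvector, so the
derivative is the eigenvalue, whatever the starting state. -/
theorem hasDerivAt_stepRatio {lam : ℝ} (hlam : 0 < lam) (c : ℝ) (s : ℤˣ) :
    HasDerivAt (stepRatio lam c s) (growth lam c) 0 := by
  have h1 : ∀ s' : ℤˣ, HasDerivAt (fun x : ℝ => NormedSpace.exp (x • generator lam) s s' *
      (Real.exp (c * (x * ((s' : ℤ) : ℝ))) * eigenvector lam c s'))
      (generator lam s s' * eigenvector lam c s' +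
        (1 : Matrix ℤˣ ℤˣ ℝ) s s' * (c * ((s' : ℤ) : ℝ) * eigenvector lam c s')) 0 := by
    intro s'
    have h2 : HasDerivAt (fun x : ℝ => Real.exp (c * (x * ((s' : ℤ) : ℝ))) * eigenvector lam c s')
        (c * ((s' : ℤ) : ℝ) * eigenvector lam c s') 0 := by
      have := ((((hasDerivAt_id (0 : ℝ)).mul_const ((s' : ℤ) : ℝ)).const_mul c).exp).mul_const
        (eigenvector lam c s')
      simpa using this
    have := (hasDerivAt_exp_smul_apply (generator lam) s s').fun_mul h2
    simpa using this
  have h := (HasDerivAt.fun_sum (u := Finset.univ) fun s' _ => h1 s').div_const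
    (eigenvector lam c s)
  have h0 := (eigenvector_pos hlam c s).ne'
  have hval : growth lam c = (∑ s', (generator lam s s' * eigenvector lam c s' +
        (1 : Matrix ℤˣ ℤˣ ℝ) s s' * (c * ((s' : ℤ) : ℝ) * eigenvector lam c s')))
        / eigenvector lam c s := by
    rw [eq_div_iff h0, ← sum_generator_mul_eigenvector, Finset.sum_add_distrib]
    simp [-UnitsInt.univ, Matrix.one_apply]
  rw [hval]
  exact h

/-- If `f 0 = 1` and `f' 0 = d`, then `n (f (T / n) - 1) → d T`. -/
theorem tendsto_mul_sub_one_of_hasDerivAt {f : ℝ → ℝ} {d : ℝ} (hf : HasDerivAt f d 0)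
    (h0 : f 0 = 1) (T : ℝ) :
    Tendsto (fun n : ℕ => (n : ℝ) * (f (T / n) - 1)) atTop (𝓝 (d * T)) := by
  have h1 : HasDerivAt (fun x => f (T * x)) (d * T) 0 := by
    have h2 : HasDerivAt (fun x : ℝ => T * x) T 0 := by
      simpa using (hasDerivAt_id (0 : ℝ)).const_mul T
    have h3 : HasDerivAt f d (T * 0) := by simpa using hf
    exact h3.comp (0 : ℝ) h2
  have h2 := h1.tendsto_slope_zero
  have h3 : Tendsto (fun n : ℕ => 1 / (n : ℝ)) atTop (𝓝[≠] 0) := by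
    refine tendsto_nhdsWithin_iff.2 ⟨tendsto_one_div_atTop_nhds_zero_nat, ?_⟩
    filter_upwards [eventually_gt_atTop 0] with n hn
    have hn' : (n : ℝ) ≠ 0 := by exact_mod_cast hn.ne'
    simpa using hn'
  refine (h2.comp h3).congr fun n => ?_
  simp [h0, div_eq_mul_inv]

instance : MeasurableSingletonClass ℤˣ where
  measurableSet_singleton s :=
    ⟨{(s : ℤ)}, measurableSet_singleton _, by ext r; simp [Units.ext_iff]⟩

/-! ### Measurability of grid sums and of the occupation integral -/

section Path

variable {Ω : Type*}

theorem measurable_path_past (ξ : ℝ≥0 → Ω → ℤˣ) {u t : ℝ≥0} (h : u ≤ t) :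
    Measurable[past ξ t] (ξ u) := by
  rw [measurable_iff_comap_le]
  exact le_iSup₂ (f := fun (u : ℝ≥0) (_ : u ≤ t) =>
    MeasurableSpace.comap (ξ u) inferInstance) u h

theorem measurable_gridSum_past (ξ : ℝ≥0 → Ω → ℤˣ) (h : ℝ≥0) (n : ℕ) :
    Measurable[past ξ (n * h)] (gridSum ξ h n) := by
  unfold gridSum
  refine Finset.measurable_fun_sum _ fun k hk => ?_
  have hk' : ((k + 1 : ℕ) : ℝ≥0) * h ≤ n * h := by
    gcongr
    exact Finset.mem_range.1 hk
  exact (measurable_of_countable fun s : ℤˣ => (h : ℝ) * ((s : ℤ) : ℝ)).comp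
    (measurable_path_past ξ hk')

theorem measurable_occupation [MeasurableSpace Ω] {ξ : ℝ≥0 → Ω → ℤˣ} (hm : ∀ t, Measurable (ξ t))
    (hr : ∀ ω t, ∀ᶠ u in 𝓝[≥] t, ξ u ω = ξ t ω) (T : ℝ≥0) : Measurable (occupation ξ T) :=
  measurable_of_tendsto_metrizable
    (fun n : ℕ => (measurable_gridSum_past ξ (T / n) n).mono (past_le hm _) le_rfl)
    (tendsto_pi_nhds.2 fun ω => tendsto_gridSum (hr ω) T)

theorem exp_mul_le {c x M : ℝ} (hx : |x| ≤ M) : Real.exp (c * x) ≤ Real.exp (|c| * M) := by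
  refine Real.exp_le_exp.2 ((le_abs_self _).trans ?_)
  rw [abs_mul]
  gcongr

theorem abs_exp_gridSum_le (c : ℝ) (ξ : ℝ≥0 → Ω → ℤˣ) (h : ℝ≥0) (n : ℕ) (ω : Ω) :
    |Real.exp (c * gridSum ξ h n ω)| ≤ Real.exp (|c| * (n * h)) := by
  rw [Real.abs_exp]
  exact exp_mul_le (abs_gridSum_le ξ h n ω)

end Path

/-! ### Exponential moments of the occupation integral -/

section Chain

variable {Ω : Type*} [mΩ : MeasurableSpace Ω] {P : Measure Ω} [IsProbabilityMeasure P]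
  {lam : ℝ} {s₀ : ℤˣ} {ξ : ℝ≥0 → Ω → ℤˣ}

/-- The Markov property, tested against a bounded functional of the past. -/
theorem IsChain.integral_mul_comp (hξ : IsChain P lam s₀ ξ) (t h : ℝ≥0) (g : ℤˣ → ℝ)
    {W : Ω → ℝ} {C : ℝ} (hW : StronglyMeasurable[past ξ t] W) (hC : ∀ ω, |W ω| ≤ C) :
    ∫ ω, W ω * g (ξ (t + h) ω) ∂P
      = ∫ ω, W ω * ∑ s', transition lam h (ξ t ω) s' * g s' ∂P := by
  have hm := past_le hξ.measurable t
  have hWm : AEStronglyMeasurable W P := (hW.mono hm).aestronglyMeasurable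
  have hset : ∀ s : ℤˣ, MeasurableSet {ω | ξ (t + h) ω = s} := fun s =>
    hξ.measurable (t + h) (measurableSet_singleton s)
  have hind : ∀ s : ℤˣ,
      Integrable (Set.indicator {ω | ξ (t + h) ω = s} (fun _ => (1 : ℝ))) P := fun s =>
    (integrable_const 1).indicator (hset s)
  have hWi : ∀ s : ℤˣ,
      Integrable (W * Set.indicator {ω | ξ (t + h) ω = s} (fun _ => (1 : ℝ))) P := fun s =>
    (hind s).bdd_mul (c := C) hWm (Eventually.of_forall fun ω => hC ω)
  have hWt : ∀ s : ℤˣ, Integrable (fun ω => W ω * transition lam h (ξ t ω) s) P := by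
    intro s
    refine Integrable.bdd_mul (c := C) ?_ hWm (Eventually.of_forall fun ω => hC ω)
    have hmeas : Measurable fun ω => transition lam h (ξ t ω) s :=
      (measurable_of_countable fun r : ℤˣ => transition lam h r s).comp (hξ.measurable t)
    exact Integrable.of_bound hmeas.aestronglyMeasurable
      (∑ r, |transition lam h r s|) (Eventually.of_forall fun ω =>
        Finset.single_le_sum (f := fun r => |transition lam h r s|)
          (fun _ _ => abs_nonneg _) (Finset.mem_univ _))
  -- `W` is known at time `t`, so it comes out of the conditional expectation; `g` is then recovered
  -- as a combination of indicators.
  have key : ∀ s : ℤˣ,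
      ∫ ω, (W * Set.indicator {ω | ξ (t + h) ω = s} (fun _ => (1 : ℝ))) ω ∂P
        = ∫ ω, W ω * transition lam h (ξ t ω) s ∂P := by
    intro s
    rw [← integral_condExp hm]
    refine integral_congr_ae ?_
    filter_upwards [condExp_mul_of_stronglyMeasurable_left hW (hWi s) (hind s),
      hξ.markov t h s] with ω h1 h2
    rw [h1, Pi.mul_apply, h2]
  have hL : ∀ ω, W ω * g (ξ (t + h) ω) = ∑ s',
      (W * Set.indicator {ω | ξ (t + h) ω = s'} (fun _ => (1 : ℝ))) ω * g s' := by
    intro ω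
    simp [-UnitsInt.univ, Set.indicator_apply]
  have hR : ∀ ω, W ω * ∑ s', transition lam h (ξ t ω) s' * g s'
      = ∑ s', W ω * transition lam h (ξ t ω) s' * g s' := by
    intro ω
    simp only [Finset.mul_sum, mul_assoc]
  simp only [hL, hR]
  rw [integral_finsetSum _ fun s _ => (hWi s).mul_const _,
    integral_finsetSum _ fun s _ => (hWt s).mul_const _]
  refine Finset.sum_congr rfl fun s _ => ?_
  rw [integral_mul_const, integral_mul_const, key]

/-- The mean of `exp (c ∫ ξ) * eigenvector (ξ)`, with the integral replaced by a Riemann sum. -/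
noncomputable def gridMean (P : Measure Ω) (lam c : ℝ) (ξ : ℝ≥0 → Ω → ℤˣ) (h : ℝ≥0) (n : ℕ) : ℝ :=
  ∫ ω, Real.exp (c * gridSum ξ h n ω) * eigenvector lam c (ξ (n * h) ω) ∂P

theorem abs_eigenvector_le (lam c : ℝ) (s : ℤˣ) :
    |eigenvector lam c s| ≤ ∑ r, |eigenvector lam c r| :=
  Finset.single_le_sum (f := fun r => |eigenvector lam c r|) (fun _ _ => abs_nonneg _)
    (Finset.mem_univ _)

/-- With right endpoints the new factor depends only on the state at the new grid time, so the
Markov property averages it out given the past. -/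
theorem IsChain.gridMean_succ (hξ : IsChain P lam s₀ ξ) (hlam : 0 < lam) (c : ℝ) (h : ℝ≥0)
    (n : ℕ) :
    gridMean P lam c ξ h (n + 1) = ∫ ω, Real.exp (c * gridSum ξ h n ω) *
      (stepRatio lam c (ξ (n * h) ω) h * eigenvector lam c (ξ (n * h) ω)) ∂P := by
  have hW : StronglyMeasurable[past ξ (n * h)] fun ω => Real.exp (c * gridSum ξ h n ω) :=
    (Real.measurable_exp.comp ((measurable_gridSum_past ξ h n).const_mul c)).stronglyMeasurable
  have := hξ.integral_mul_comp (n * h) h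
    (fun s => Real.exp (c * (h * ((s : ℤ) : ℝ))) * eigenvector lam c s) hW
    (abs_exp_gridSum_le c ξ h n)
  have ht : (n : ℝ≥0) * h + h = ((n + 1 : ℕ) : ℝ≥0) * h := by
    push_cast
    ring
  rw [ht] at this
  refine Eq.trans (integral_congr_ae (Eventually.of_forall fun ω => ?_)) (this.trans
    (integral_congr_ae (Eventually.of_forall fun ω => ?_)))
  · simp only [gridSum, Finset.sum_range_succ, mul_add, Real.exp_add]
    ring
  · simp only [stepRatio, transition]
    rw [div_mul_cancel₀ _ (eigenvector_pos hlam c _).ne']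

theorem IsChain.integrable_grid (hξ : IsChain P lam s₀ ξ) (c : ℝ) (h : ℝ≥0) (n : ℕ)
    (g : ℤˣ → ℝ) :
    Integrable (fun ω => Real.exp (c * gridSum ξ h n ω) * g (ξ (n * h) ω)) P := by
  have hm : Measurable fun ω => Real.exp (c * gridSum ξ h n ω) * g (ξ (n * h) ω) :=
    (Real.measurable_exp.comp (((measurable_gridSum_past ξ h n).mono
      (past_le hξ.measurable _) le_rfl).const_mul c)).mul
      ((measurable_of_countable g).comp (hξ.measurable _))
  refine Integrable.of_bound hm.aestronglyMeasurable
    (Real.exp (|c| * (n * h)) * ∑ r, |g r|) (Eventually.of_forall fun ω => ?_)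
  rw [Real.norm_eq_abs, abs_mul]
  gcongr
  · exact abs_exp_gridSum_le c ξ h n ω
  · exact Finset.single_le_sum (f := fun r => |g r|) (fun _ _ => abs_nonneg _) (Finset.mem_univ _)

theorem IsChain.gridMean_zero (hξ : IsChain P lam s₀ ξ) (c : ℝ) (h : ℝ≥0) :
    gridMean P lam c ξ h 0 = eigenvector lam c s₀ := by
  have : gridMean P lam c ξ h 0 = ∫ _ω, eigenvector lam c s₀ ∂P := by
    refine integral_congr_ae ?_
    filter_upwards [hξ.initial] with ω hω
    simp [gridSum, hω]
  simpa using this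

theorem IsChain.le_gridMean (hξ : IsChain P lam s₀ ξ) (hlam : 0 < lam) (c : ℝ) (h : ℝ≥0) {q : ℝ}
    (hq : 0 ≤ q) (hle : ∀ s, q ≤ stepRatio lam c s h) (n : ℕ) :
    q ^ n * eigenvector lam c s₀ ≤ gridMean P lam c ξ h n := by
  induction n with
  | zero => simp [hξ.gridMean_zero]
  | succ n ih =>
    rw [hξ.gridMean_succ hlam, pow_succ', mul_assoc]
    refine (mul_le_mul_of_nonneg_left ih hq).trans ?_
    rw [gridMean, ← integral_const_mul]
    refine integral_mono ((hξ.integrable_grid c h n _).const_mul q) (hξ.integrable_grid c h n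
      fun s => stepRatio lam c s h * eigenvector lam c s) fun ω => ?_
    have := mul_le_mul_of_nonneg_right (hle (ξ (n * h) ω))
      (mul_pos (Real.exp_pos (c * gridSum ξ h n ω)) (eigenvector_pos hlam c (ξ (n * h) ω))).le
    dsimp only
    linarith

theorem IsChain.gridMean_le (hξ : IsChain P lam s₀ ξ) (hlam : 0 < lam) (c : ℝ) (h : ℝ≥0) {q : ℝ}
    (hq : 0 ≤ q) (hle : ∀ s, stepRatio lam c s h ≤ q) (n : ℕ) :
    gridMean P lam c ξ h n ≤ q ^ n * eigenvector lam c s₀ := by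
  induction n with
  | zero => simp [hξ.gridMean_zero]
  | succ n ih =>
    rw [hξ.gridMean_succ hlam, pow_succ', mul_assoc]
    refine le_trans ?_ (mul_le_mul_of_nonneg_left ih hq)
    rw [gridMean, ← integral_const_mul]
    refine integral_mono (hξ.integrable_grid c h n
      fun s => stepRatio lam c s h * eigenvector lam c s)
      ((hξ.integrable_grid c h n _).const_mul q) fun ω => ?_
    have := mul_le_mul_of_nonneg_right (hle (ξ (n * h) ω))
      (mul_pos (Real.exp_pos (c * gridSum ξ h n ω)) (eigenvector_pos hlam c (ξ (n * h) ω))).le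
    dsimp only
    linarith

/-- Each step multiplies the mean by a factor between the smaller and the larger `stepRatio`. Both
are `1 + growth · T/n + o(1/n)`, so their `n`-th powers squeeze the mean to the exponential. -/
theorem IsChain.tendsto_gridMean (hξ : IsChain P lam s₀ ξ) (hlam : 0 < lam) (c : ℝ) (T : ℝ≥0) :
    Tendsto (fun n : ℕ => gridMean P lam c ξ (T / n) n) atTop
      (𝓝 (Real.exp (growth lam c * T) * eigenvector lam c s₀)) := by
  have hs : ∀ s : ℤˣ, Tendsto (fun n : ℕ => (n : ℝ) * (stepRatio lam c s (T / n) - 1)) atTop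
      (𝓝 (growth lam c * T)) := fun s =>
    tendsto_mul_sub_one_of_hasDerivAt (hasDerivAt_stepRatio hlam c s) (stepRatio_zero hlam c s) T
  have hs0 : ∀ s : ℤˣ, ∀ᶠ n : ℕ in atTop, 0 < stepRatio lam c s (T / n) := by
    intro s
    have h1 : Tendsto (fun n : ℕ => (T : ℝ) / n) atTop (𝓝 0) :=
      tendsto_const_div_atTop_nhds_zero_nat _
    have h2 := (hasDerivAt_stepRatio hlam c s).continuousAt.tendsto.comp h1
    rw [stepRatio_zero hlam] at h2
    exact h2.eventually (lt_mem_nhds one_pos)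
  have hpow : ∀ g : ℕ → ℝ, Tendsto (fun n : ℕ => (n : ℝ) * (g n - 1)) atTop
      (𝓝 (growth lam c * T)) → Tendsto (fun n => g n ^ n * eigenvector lam c s₀) atTop
        (𝓝 (Real.exp (growth lam c * T) * eigenvector lam c s₀)) := by
    intro g hg
    have := (Real.tendsto_one_add_pow_exp_of_tendsto hg).mul_const (eigenvector lam c s₀)
    simpa using this
  have hmin : Tendsto (fun n : ℕ => (n : ℝ) *
      (min (stepRatio lam c 1 (T / n)) (stepRatio lam c (-1) (T / n)) - 1)) atTop
      (𝓝 (growth lam c * T)) := by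
    have := (hs 1).min (hs (-1))
    rw [min_self] at this
    refine this.congr fun n => ?_
    rw [← mul_min_of_nonneg _ _ (Nat.cast_nonneg n), min_sub_sub_right]
  have hmax : Tendsto (fun n : ℕ => (n : ℝ) *
      (max (stepRatio lam c 1 (T / n)) (stepRatio lam c (-1) (T / n)) - 1)) atTop
      (𝓝 (growth lam c * T)) := by
    have := (hs 1).max (hs (-1))
    rw [max_self] at this
    refine this.congr fun n => ?_
    rw [← mul_max_of_nonneg _ _ (Nat.cast_nonneg n), max_sub_sub_right]
  refine tendsto_of_tendsto_of_tendsto_of_le_of_le' (hpow _ hmin) (hpow _ hmax) ?_ ?_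
  · filter_upwards [hs0 1, hs0 (-1)] with n h1 h2
    refine hξ.le_gridMean hlam c _ (le_min h1.le h2.le) (fun s => ?_) n
    rcases Int.units_eq_one_or s with rfl | rfl <;> simp
  · filter_upwards [hs0 1, hs0 (-1)] with n h1 h2
    refine hξ.gridMean_le hlam c _ (h1.le.trans (le_max_left _ _)) (fun s => ?_) n
    rcases Int.units_eq_one_or s with rfl | rfl <;> simp

theorem IsChain.integrable_exp_occupation (hξ : IsChain P lam s₀ ξ) (c : ℝ) (T : ℝ≥0) :
    Integrable (fun ω => Real.exp (c * occupation ξ T ω)) P := by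
  refine Integrable.of_bound
    (Real.measurable_exp.comp ((measurable_occupation hξ.measurable hξ.right_continuous T).const_mul c)).aestronglyMeasurable
    (Real.exp (|c| * T)) (Eventually.of_forall fun ω => ?_)
  rw [Real.norm_eq_abs, Real.abs_exp]
  exact exp_mul_le (abs_occupation_le ξ T ω)

/-- The exponential of the occupation integral, weighted by the eigenvector, grows exactly at the
rate `growth lam c`. -/
theorem IsChain.integral_exp_mul_eigenvector (hξ : IsChain P lam s₀ ξ) (hlam : 0 < lam) (c : ℝ)
    (T : ℝ≥0) :
    ∫ ω, Real.exp (c * occupation ξ T ω) * eigenvector lam c (ξ T ω) ∂P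
      = Real.exp (growth lam c * T) * eigenvector lam c s₀ := by
  refine tendsto_nhds_unique ?_ (hξ.tendsto_gridMean hlam c T)
  have := tendsto_integral_of_dominated_convergence (μ := P)
    (F := fun (n : ℕ) ω =>
      Real.exp (c * gridSum ξ (T / n) n ω) * eigenvector lam c (ξ (n * (T / n)) ω))
    (f := fun ω => Real.exp (c * occupation ξ T ω) * eigenvector lam c (ξ T ω))
    (fun _ => Real.exp (|c| * T) * ∑ r, |eigenvector lam c r|)
    (fun n => (hξ.integrable_grid c (T / n) n _).aestronglyMeasurable)
    (integrable_const _) (fun n => Eventually.of_forall fun ω => ?_)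
    (Eventually.of_forall fun ω => ?_)
  · exact this
  · rw [Real.norm_eq_abs, abs_mul]
    gcongr
    · rw [Real.abs_exp]
      refine exp_mul_le ((abs_gridSum_le ξ _ n ω).trans ?_)
      rcases Nat.eq_zero_or_pos n with rfl | hn
      · simp
      · have : (n : ℝ) ≠ 0 := by exact_mod_cast hn.ne'
        push_cast
        rw [mul_div_cancel₀ _ this]
    · exact abs_eigenvector_le _ _ _
  · refine Tendsto.mul ((Real.continuous_exp.tendsto _).comp
      ((tendsto_gridSum (hξ.right_continuous ω) T).const_mul c)) ?_
    refine Tendsto.congr' ?_ tendsto_const_nhds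
    filter_upwards [eventually_gt_atTop 0] with n hn
    have : (n : ℝ≥0) ≠ 0 := by exact_mod_cast hn.ne'
    rw [mul_div_cancel₀ _ this]

/-- The exponential moments of the occupation integral grow at the rate `growth lam c`, up to
constants. -/
theorem IsChain.exists_integral_exp_bounds (hξ : IsChain P lam s₀ ξ) (hlam : 0 < lam) (c : ℝ) :
    ∃ k K : ℝ, 0 < k ∧ 0 < K ∧ ∀ T : ℝ≥0,
      k * Real.exp (growth lam c * T) ≤ ∫ ω, Real.exp (c * occupation ξ T ω) ∂P ∧
      ∫ ω, Real.exp (c * occupation ξ T ω) ∂P ≤ K * Real.exp (growth lam c * T) := by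
  have hpos := eigenvector_pos hlam c
  set m := min (eigenvector lam c 1) (eigenvector lam c (-1)) with hm
  set M := max (eigenvector lam c 1) (eigenvector lam c (-1)) with hM
  have hm0 : 0 < m := lt_min (hpos _) (hpos _)
  have hM0 : 0 < M := (hpos 1).trans_le (le_max_left _ _)
  have hmle : ∀ s, m ≤ eigenvector lam c s := fun s => by
    rcases Int.units_eq_one_or s with rfl | rfl <;> simp [hm]
  have hleM : ∀ s, eigenvector lam c s ≤ M := fun s => by
    rcases Int.units_eq_one_or s with rfl | rfl <;> simp [hM]
  -- Replacing the eigenvector weight in the exact identity by its maximum or minimum gives these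
  -- constants.
  refine ⟨eigenvector lam c s₀ / M, eigenvector lam c s₀ / m, div_pos (hpos _) hM0,
    div_pos (hpos _) hm0, fun T => ?_⟩
  have hI := hξ.integrable_exp_occupation c T
  have hIe : Integrable (fun ω =>
      Real.exp (c * occupation ξ T ω) * eigenvector lam c (ξ T ω)) P := by
    refine hI.mul_bdd (c := M) ?_ (Eventually.of_forall fun ω => ?_)
    · exact ((measurable_of_countable (eigenvector lam c)).comp
        (hξ.measurable T)).aestronglyMeasurable
    · rw [Real.norm_eq_abs, abs_of_pos (hpos _)]
      exact hleM _
  have heq := hξ.integral_exp_mul_eigenvector hlam c T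
  constructor
  · rw [div_mul_eq_mul_div, div_le_iff₀ hM0, mul_comm (eigenvector lam c s₀), ← heq,
      ← integral_mul_const]
    exact integral_mono hIe (hI.mul_const M) fun ω =>
      mul_le_mul_of_nonneg_left (hleM _) (Real.exp_pos _).le
  · rw [div_mul_eq_mul_div, le_div_iff₀ hm0, mul_comm (eigenvector lam c s₀), ← heq,
      ← integral_mul_const]
    exact integral_mono (hI.mul_const m) hIe fun ω =>
      mul_le_mul_of_nonneg_left (hmle _) (Real.exp_pos _).le

end Chain

/-! ### The discounted price -/

section Discounted

variable {Ω : Type*}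

/-- The discounted price `exp(-ρ t) Y_t`. -/
noncomputable def discounted (mu sig rho y₀ : ℝ) (ξ : ℝ≥0 → Ω → ℤˣ) (t : ℝ≥0) (ω : Ω) : ℝ :=
  y₀ * Real.exp ((mu - rho) * t) * Real.exp (sig * occupation ξ t ω)

theorem reward_eq (mu sig rho a y₀ : ℝ) (ξ : ℝ≥0 → Ω → ℤˣ) (t : ℝ≥0) (ω : Ω) :
    reward mu sig rho a y₀ ξ t ω
      = discounted mu sig rho y₀ ξ t ω - a * Real.exp (-rho * t) := by
  have h : (mu - rho) * t = mu * t + -rho * t := by ring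
  rw [reward, price, discounted, ← occupation, h, Real.exp_add, Real.exp_add]
  ring

theorem discounted_pos {y₀ : ℝ} (hy₀ : 0 < y₀) (mu sig rho : ℝ) (ξ : ℝ≥0 → Ω → ℤˣ) (t : ℝ≥0)
    (ω : Ω) : 0 < discounted mu sig rho y₀ ξ t ω := by
  unfold discounted
  positivity

/-- This lets the first-moment estimates be applied to the square root of the price. -/
theorem discounted_half_sq {y₀ : ℝ} (hy₀ : 0 < y₀) (mu sig rho : ℝ) (ξ : ℝ≥0 → Ω → ℤˣ) (t : ℝ≥0)
    (ω : Ω) : discounted (mu / 2) (sig / 2) (rho / 2) (Real.sqrt y₀) ξ t ω ^ 2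
      = discounted mu sig rho y₀ ξ t ω := by
  simp only [discounted, mul_pow, Real.sq_sqrt hy₀.le, ← Real.exp_nat_mul]
  push_cast
  have h1 : 2 * ((mu / 2 - rho / 2) * (t : ℝ)) = (mu - rho) * t := by ring
  have h2 : 2 * (sig / 2 * occupation ξ t ω) = sig * occupation ξ t ω := by ring
  rw [h1, h2]

/-- On unit time intervals the discounted price grows at most by a constant factor. -/
theorem discounted_le_floor {mu sig rho y₀ : ℝ} (hmu : 0 < mu) (hsig : 0 < sig) (hrho : 0 < rho)
    (hy₀ : 0 < y₀) {ξ : ℝ≥0 → Ω → ℤˣ} {ω : Ω}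
    (hξ : ∀ t, ∀ᶠ u in 𝓝[≥] t, ξ u ω = ξ t ω) (t : ℝ≥0) :
    discounted mu sig rho y₀ ξ t ω
      ≤ Real.exp (mu + sig) * discounted mu sig rho y₀ ξ (⌊t⌋₊ : ℝ≥0) ω := by
  have h1 : ((⌊t⌋₊ : ℝ≥0) : ℝ≥0) ≤ t := Nat.floor_le t.2
  have h2 : t < (⌊t⌋₊ : ℝ≥0) + 1 := Nat.lt_floor_add_one t
  have h3 := occupation_le_add hξ h1
  set s : ℝ≥0 := (⌊t⌋₊ : ℝ≥0)
  have h1' : (s : ℝ) ≤ t := by exact_mod_cast h1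
  have h2' : (t : ℝ) < s + 1 := by exact_mod_cast h2
  simp only [discounted, mul_assoc]
  rw [mul_left_comm (Real.exp (mu + sig))]
  simp only [← Real.exp_add]
  refine mul_le_mul_of_nonneg_left (Real.exp_le_exp.2 ?_) hy₀.le
  -- The exponent rises by at most `(mu - rho + sig)(t - s)` with `0 ≤ t - s < 1`, and discounting
  -- only helps.
  have h4 := mul_le_mul_of_nonneg_left h3 hsig.le
  nlinarith [mul_nonneg hrho.le (sub_nonneg.2 h1')]

theorem IsChain.measurable_ofReal_discounted [MeasurableSpace Ω] {P : Measure Ω} {lam : ℝ} {s₀ : ℤˣ} {ξ : ℝ≥0 → Ω → ℤˣ}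
    (hξ : IsChain P lam s₀ ξ) (mu sig rho y₀ : ℝ)
    (t : ℝ≥0) : Measurable fun ω => ENNReal.ofReal (discounted mu sig rho y₀ ξ t ω) :=
  ENNReal.measurable_ofReal.comp ((Real.measurable_exp.comp
    ((measurable_occupation hξ.measurable hξ.right_continuous t).const_mul sig)).const_mul _)

end Discounted

/-! ### Extended expectations and the optimal value -/

section Expectation

variable {Ω : Type*} [mΩ : MeasurableSpace Ω] {P : Measure Ω}

theorem expectation_eq_integral {Z : Ω → ℝ} (hZ : Integrable Z P) :
    expectation P Z = ((∫ ω, Z ω ∂P : ℝ) : EReal) := by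
  have h1 : ∫⁻ ω, ENNReal.ofReal (Z ω) ∂P ≠ ∞ := hZ.lintegral_lt_top.ne
  have h2 : ∫⁻ ω, ENNReal.ofReal (-Z ω) ∂P ≠ ∞ := hZ.neg.lintegral_lt_top.ne
  rw [integral_eq_lintegral_pos_part_sub_lintegral_neg_part hZ, EReal.coe_sub,
    EReal.coe_ennreal_toReal h1, EReal.coe_ennreal_toReal h2, expectation]

theorem expectation_le {Z : Ω → ℝ} {S : Ω → ℝ≥0∞} (h : ∀ ω, ENNReal.ofReal (Z ω) ≤ S ω) :
    expectation P Z ≤ ((∫⁻ ω, S ω ∂P : ℝ≥0∞) : EReal) := by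
  refine (EReal.sub_le_sub (EReal.coe_ennreal_le_coe_ennreal_iff.2 (lintegral_mono h))
    (EReal.coe_ennreal_nonneg _)).trans_eq (sub_zero _)

/-- The running supremum dominates `X_τ` pathwise, including where `τ = ∞` and the reward is `0`. -/
theorem value_lt_top {ℱ : Filtration ℝ≥0 mΩ} {X : ℝ≥0 → Ω → ℝ}
    (hX : ∫⁻ ω, (⨆ t : ℝ≥0, ENNReal.ofReal |X t ω|) ∂P < ⊤) : value P ℱ X < ⊤ := by
  refine lt_of_le_of_lt (iSup_le fun τ => expectation_le fun ω => ?_)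
    (lt_top_iff_ne_top.2 (by simpa using hX.ne))
  unfold valueAt
  split
  · simp
  · exact (ENNReal.ofReal_le_ofReal (le_abs_self _)).trans
      (le_iSup (fun t : ℝ≥0 => ENNReal.ofReal |X t ω|) _)

end Expectation

/-! ### The phase transition at the critical discount rate -/

section Chain

variable {Ω : Type*} [mΩ : MeasurableSpace Ω] {P : Measure Ω} [IsProbabilityMeasure P]
  {lam mu sig rho a y₀ : ℝ} {s₀ : ℤˣ} {ξ : ℝ≥0 → Ω → ℤˣ}

theorem IsChain.integrable_discounted (hξ : IsChain P lam s₀ ξ) (mu sig rho y₀ : ℝ) (t : ℝ≥0) :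
    Integrable (discounted mu sig rho y₀ ξ t) P :=
  (hξ.integrable_exp_occupation sig t).const_mul _

theorem IsChain.exists_integral_discounted_bounds (hξ : IsChain P lam s₀ ξ) (hlam : 0 < lam)
    (mu sig rho : ℝ) (hy₀ : 0 < y₀) :
    ∃ k K : ℝ, 0 < k ∧ 0 < K ∧ ∀ t : ℝ≥0,
      k * Real.exp ((mu + growth lam sig - rho) * t) ≤ ∫ ω, discounted mu sig rho y₀ ξ t ω ∂P ∧
      ∫ ω, discounted mu sig rho y₀ ξ t ω ∂P
        ≤ K * Real.exp ((mu + growth lam sig - rho) * t) := by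
  obtain ⟨k, K, hk, hK, h⟩ := hξ.exists_integral_exp_bounds hlam sig
  refine ⟨y₀ * k, y₀ * K, by positivity, by positivity, fun t => ?_⟩
  have he : (mu + growth lam sig - rho) * t = (mu - rho) * t + growth lam sig * t := by ring
  have h0 : 0 ≤ y₀ * Real.exp ((mu - rho) * t) := by positivity
  simp only [discounted, integral_const_mul, he, Real.exp_add]
  constructor
  · linarith [mul_le_mul_of_nonneg_left (h t).1 h0]
  · linarith [mul_le_mul_of_nonneg_left (h t).2 h0]

theorem IsChain.expectation_reward (hξ : IsChain P lam s₀ ξ) (mu sig rho a y₀ : ℝ) (t : ℝ≥0) :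
    expectation P (reward mu sig rho a y₀ ξ t)
      = ((∫ ω, discounted mu sig rho y₀ ξ t ω ∂P - a * Real.exp (-rho * t) : ℝ) : EReal) := by
  have hD := hξ.integrable_discounted mu sig rho y₀ t
  have h : reward mu sig rho a y₀ ξ t
      = fun ω => discounted mu sig rho y₀ ξ t ω - a * Real.exp (-rho * t) :=
    funext fun ω => reward_eq mu sig rho a y₀ ξ t ω
  rw [h, expectation_eq_integral
    (Z := fun ω => discounted mu sig rho y₀ ξ t ω - a * Real.exp (-rho * t))
    (hD.sub (integrable_const _)),
    integral_sub hD (integrable_const _)]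
  simp

theorem IsChain.iSup_expectation_reward_eq_top_iff (hξ : IsChain P lam s₀ ξ) (hlam : 0 < lam)
    (mu sig : ℝ) (hrho : 0 < rho) (ha : 0 < a) (hy₀ : 0 < y₀) :
    rho < mu + growth lam sig ↔ (⨆ t : ℝ≥0, expectation P (reward mu sig rho a y₀ ξ t)) = ⊤ := by
  obtain ⟨k, K, hk, hK, h⟩ := hξ.exists_integral_discounted_bounds hlam mu sig rho hy₀
  have hdisc : ∀ t : ℝ≥0, Real.exp (-rho * t) ≤ 1 := fun t =>
    Real.exp_le_one_iff.2 (by nlinarith [t.2, (NNReal.coe_nonneg t)])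
  constructor
  · intro hlt
    have hd : 0 < mu + growth lam sig - rho := by linarith
    refine iSup_eq_top.2 fun b hb => ?_
    obtain ⟨r, hbr, -⟩ := EReal.lt_iff_exists_real_btwn.1 hb
    -- Chosen so that `exp x ≥ x + 1` makes the mean price at least `|r| + a`, the extra `a` paying
    -- for the strike.
    obtain ⟨t, ht⟩ : ∃ t : ℝ≥0, (t : ℝ) = (|r| + a) / k / (mu + growth lam sig - rho) :=
      ⟨_, Real.coe_toNNReal _ (by positivity)⟩
    refine ⟨t, hbr.trans_le ?_⟩
    rw [hξ.expectation_reward, EReal.coe_le_coe_iff]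
    have h1 : k * ((mu + growth lam sig - rho) * t) = |r| + a := by
      rw [ht]
      field_simp
    have h2 := mul_le_mul_of_nonneg_left
      (Real.add_one_le_exp ((mu + growth lam sig - rho) * t)) hk.le
    nlinarith [(h t).1, hdisc t, le_abs_self r]
  · intro htop
    by_contra! hle
    refine absurd htop (ne_of_lt (lt_of_le_of_lt (iSup_le fun t => ?_) (EReal.coe_lt_top K)))
    rw [hξ.expectation_reward, EReal.coe_le_coe_iff]
    have h1 : Real.exp ((mu + growth lam sig - rho) * t) ≤ 1 :=
      Real.exp_le_one_iff.2 (mul_nonpos_of_nonpos_of_nonneg (by linarith) t.2)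
    nlinarith [(h t).2, mul_pos ha (Real.exp_pos (-rho * t))]

/-- If the mean of the discounted price decays, then its means at integer times are summable. -/
theorem IsChain.tsum_lintegral_discounted_ne_top (hξ : IsChain P lam s₀ ξ) (hlam : 0 < lam)
    (hy₀ : 0 < y₀) (hlt : mu + growth lam sig < rho) :
    ∑' n : ℕ, ∫⁻ ω, ENNReal.ofReal (discounted mu sig rho y₀ ξ (n : ℝ≥0) ω) ∂P ≠ ∞ := by
  obtain ⟨k, K, hk, hK, h⟩ := hξ.exists_integral_discounted_bounds hlam mu sig rho hy₀
  have hsum : Summable fun n : ℕ => K * Real.exp (mu + growth lam sig - rho) ^ n :=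
    (summable_geometric_of_lt_one (Real.exp_pos _).le
      (by rw [Real.exp_lt_one_iff]; linarith)).mul_left K
  refine ne_top_of_le_ne_top hsum.tsum_ofReal_ne_top (ENNReal.tsum_le_tsum fun n => ?_)
  rw [← ofReal_integral_eq_lintegral_ofReal (hξ.integrable_discounted mu sig rho y₀ n)
    (Eventually.of_forall fun ω => (discounted_pos hy₀ mu sig rho ξ n ω).le)]
  refine ENNReal.ofReal_le_ofReal ((h n).2.trans_eq ?_)
  rw [← Real.exp_nat_mul, NNReal.coe_natCast, mul_comm (n : ℝ)]

theorem IsChain.lintegral_iSup_reward_lt_top (hξ : IsChain P lam s₀ ξ) (hlam : 0 < lam)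
    (hmu : 0 < mu) (hsig : 0 < sig) (hrho : 0 < rho) (ha : 0 < a) (hy₀ : 0 < y₀)
    (hlt : mu + growth lam sig < rho) :
    ∫⁻ ω, (⨆ t : ℝ≥0, ENNReal.ofReal |reward mu sig rho a y₀ ξ t ω|) ∂P < ⊤ := by
  -- The uncountable supremum is replaced by a measurable series over integer times.
  have hbound : ∀ ω, (⨆ t : ℝ≥0, ENNReal.ofReal |reward mu sig rho a y₀ ξ t ω|)
      ≤ ENNReal.ofReal a + ENNReal.ofReal (Real.exp (mu + sig)) *
        ∑' n : ℕ, ENNReal.ofReal (discounted mu sig rho y₀ ξ (n : ℝ≥0) ω) := by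
    intro ω
    refine iSup_le fun t => ?_
    have h1 : |reward mu sig rho a y₀ ξ t ω| ≤ a + Real.exp (mu + sig) *
        discounted mu sig rho y₀ ξ (⌊t⌋₊ : ℝ≥0) ω := by
      have h2 := discounted_le_floor hmu hsig hrho hy₀ (hξ.right_continuous ω) t
      have h3 := discounted_pos hy₀ mu sig rho ξ t ω
      have h4 : Real.exp (-rho * t) ≤ 1 :=
        Real.exp_le_one_iff.2 (by nlinarith [NNReal.coe_nonneg t])
      have h5 := Real.exp_pos (-rho * t)
      rw [reward_eq, abs_le]
      constructor <;> nlinarith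
    refine (ENNReal.ofReal_le_ofReal h1).trans ?_
    rw [ENNReal.ofReal_add ha.le
      (mul_nonneg (Real.exp_pos _).le (discounted_pos hy₀ mu sig rho ξ _ ω).le),
      ENNReal.ofReal_mul (Real.exp_pos _).le]
    gcongr
    exact ENNReal.le_tsum (f := fun n : ℕ =>
      ENNReal.ofReal (discounted mu sig rho y₀ ξ (n : ℝ≥0) ω)) ⌊t⌋₊
  refine (lintegral_mono hbound).trans_lt ?_
  rw [lintegral_add_left measurable_const, lintegral_const, measure_univ, mul_one,
    lintegral_const_mul' _ _ ENNReal.ofReal_ne_top,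
    lintegral_tsum fun n : ℕ => (hξ.measurable_ofReal_discounted mu sig rho y₀ n).aemeasurable]
  exact ENNReal.add_lt_top.2 ⟨ENNReal.ofReal_lt_top, ENNReal.mul_lt_top ENNReal.ofReal_lt_top
    (hξ.tsum_lintegral_discounted_ne_top hlam hy₀ hlt).lt_top⟩

/-- Strict midpoint convexity of `c ↦ √(c² + λ²)` between `0` and `sig`; after squaring it reduces
to `lam < √(sig² + lam²)`. -/
theorem growth_half_lt {lam sig : ℝ} (hlam : 0 < lam) (hsig : 0 < sig) :
    growth lam (sig / 2) < growth lam sig / 2 := by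
  have h1 : lam < Real.sqrt (sig ^ 2 + lam ^ 2) := Real.lt_sqrt_of_sq_lt (by nlinarith)
  have h2 : Real.sqrt (sig ^ 2 + lam ^ 2) ^ 2 = sig ^ 2 + lam ^ 2 := Real.sq_sqrt (by positivity)
  have h3 : Real.sqrt ((sig / 2) ^ 2 + lam ^ 2) < (Real.sqrt (sig ^ 2 + lam ^ 2) + lam) / 2 := by
    rw [Real.sqrt_lt' (by linarith)]
    nlinarith
  unfold growth
  linarith

/-- At the critical discount rate the discounted price tends to zero along the integers. -/
theorem IsChain.tendsto_discounted_zero (hξ : IsChain P lam s₀ ξ) (hlam : 0 < lam)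
    (hsig : 0 < sig) (hy₀ : 0 < y₀) (hrho : rho = mu + growth lam sig) :
    ∀ᵐ ω ∂P, Tendsto (fun n : ℕ => discounted mu sig rho y₀ ξ (n : ℝ≥0) ω) atTop (𝓝 0) := by
  -- Halved parameters are strictly supercritical, so the square roots of the prices are almost
  -- surely summable.
  have hlt : mu / 2 + growth lam (sig / 2) < rho / 2 := by
    linarith [growth_half_lt hlam hsig]
  have hfin := hξ.tsum_lintegral_discounted_ne_top hlam (Real.sqrt_pos.2 hy₀) hlt
  have hmeas : ∀ n : ℕ, Measurable fun ω => ENNReal.ofReal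
      (discounted (mu / 2) (sig / 2) (rho / 2) (Real.sqrt y₀) ξ (n : ℝ≥0) ω) := fun n =>
    hξ.measurable_ofReal_discounted _ _ _ _ _
  rw [← lintegral_tsum fun n => (hmeas n).aemeasurable] at hfin
  filter_upwards [ae_lt_top (Measurable.tsum hmeas) hfin] with ω hω
  have h1 := (ENNReal.tendsto_toReal ENNReal.zero_ne_top).comp
    (ENNReal.tendsto_atTop_zero_of_tsum_ne_top hω.ne)
  have h2 := h1.pow 2
  simp only [ENNReal.toReal_zero, ne_eq, OfNat.ofNat_ne_zero, not_false_eq_true, zero_pow] at h2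
  refine h2.congr fun n => ?_
  rw [Function.comp_apply, ENNReal.toReal_ofReal
    (discounted_pos (Real.sqrt_pos.2 hy₀) _ _ _ ξ _ ω).le, discounted_half_sq hy₀]

theorem IsChain.lt_of_lintegral_iSup_reward_lt_top (hξ : IsChain P lam s₀ ξ) (hlam : 0 < lam)
    (hsig : 0 < sig) (hrho : 0 < rho) (ha : 0 < a) (hy₀ : 0 < y₀)
    (hfin : ∫⁻ ω, (⨆ t : ℝ≥0, ENNReal.ofReal |reward mu sig rho a y₀ ξ t ω|) ∂P < ⊤) :
    mu + growth lam sig < rho := by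
  by_contra! hle
  rcases hle.lt_or_eq with hlt | heq
  · have htop := (hξ.iSup_expectation_reward_eq_top_iff hlam mu sig hrho ha hy₀).1 hlt
    have hfin' : ((∫⁻ ω, (⨆ t : ℝ≥0, ENNReal.ofReal |reward mu sig rho a y₀ ξ t ω|) ∂P : ℝ≥0∞) :
        EReal) < ⊤ := lt_top_iff_ne_top.2 (by simpa using hfin.ne)
    refine absurd htop (ne_of_lt (lt_of_le_of_lt (iSup_le fun t => ?_) hfin'))
    exact expectation_le fun ω => (ENNReal.ofReal_le_ofReal (le_abs_self _)).trans
      (le_iSup (fun t : ℝ≥0 => ENNReal.ofReal |reward mu sig rho a y₀ ξ t ω|) t)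
  · obtain ⟨k, K, hk, hK, h⟩ := hξ.exists_integral_discounted_bounds hlam mu sig rho hy₀
    have hlim : Tendsto
        (fun n : ℕ => ∫⁻ ω, ENNReal.ofReal (discounted mu sig rho y₀ ξ (n : ℝ≥0) ω) ∂P) atTop
        (𝓝 (∫⁻ _, 0 ∂P)) := by
      refine tendsto_lintegral_of_dominated_convergence (fun ω => ENNReal.ofReal a +
        ⨆ t : ℝ≥0, ENNReal.ofReal |reward mu sig rho a y₀ ξ t ω|)
        (fun n => hξ.measurable_ofReal_discounted mu sig rho y₀ n)
        (fun n => Eventually.of_forall fun ω => ?_) ?_ ?_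
      · have h4 : Real.exp (-rho * ((n : ℝ≥0) : ℝ)) ≤ 1 :=
          Real.exp_le_one_iff.2 (by nlinarith [NNReal.coe_nonneg (n : ℝ≥0)])
        have h1 : discounted mu sig rho y₀ ξ (n : ℝ≥0) ω
            ≤ a + |reward mu sig rho a y₀ ξ (n : ℝ≥0) ω| := by
          have h2 := le_abs_self (reward mu sig rho a y₀ ξ (n : ℝ≥0) ω)
          have h3 := reward_eq mu sig rho a y₀ ξ (n : ℝ≥0) ω
          nlinarith
        refine (ENNReal.ofReal_le_ofReal h1).trans ?_
        rw [ENNReal.ofReal_add ha.le (abs_nonneg _)]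
        exact add_le_add le_rfl
          (le_iSup (fun t : ℝ≥0 => ENNReal.ofReal |reward mu sig rho a y₀ ξ t ω|) (n : ℝ≥0))
      · rw [lintegral_add_left measurable_const, lintegral_const, measure_univ, mul_one]
        exact (ENNReal.add_lt_top.2 ⟨ENNReal.ofReal_lt_top, hfin⟩).ne
      · filter_upwards [hξ.tendsto_discounted_zero hlam hsig hy₀ heq] with ω hω
        have := (ENNReal.continuous_ofReal.tendsto 0).comp hω
        rwa [ENNReal.ofReal_zero] at this
    rw [lintegral_zero] at hlim
    -- At the critical rate the exponent vanishes, so every mean is at least `k > 0`.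
    refine absurd (ge_of_tendsto hlim (b := ENNReal.ofReal k) (Eventually.of_forall fun n => ?_))
      (by simpa using hk)
    rw [← ofReal_integral_eq_lintegral_ofReal (hξ.integrable_discounted mu sig rho y₀ n)
      (Eventually.of_forall fun ω => (discounted_pos hy₀ mu sig rho ξ n ω).le)]
    refine ENNReal.ofReal_le_ofReal (le_of_eq_of_le ?_ (h n).1)
    simp [heq]

end Chain

end Telegraph

theorem theorem1 {Ω : Type*} [MeasurableSpace Ω] (P : MeasureTheory.Measure Ω)
    [MeasureTheory.IsProbabilityMeasure P] [P.IsComplete]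
    (lam mu sig rho a y₀ : ℝ) (hlam : 0 < lam) (hmu : 0 < mu) (hsig : 0 < sig)
    (hrho : 0 < rho) (ha : 0 < a) (hy₀ : 0 < y₀) (s₀ : ℤˣ)
    (ξ : ℝ≥0 → Ω → ℤˣ) (hξ : Telegraph.IsChain P lam s₀ ξ) :
    (mu - lam + Real.sqrt (sig ^ 2 + lam ^ 2) < rho →
      Telegraph.value P (Telegraph.completedFiltration P ξ hξ.measurable)
        (Telegraph.reward mu sig rho a y₀ ξ) < ⊤) ∧
    (mu - lam + Real.sqrt (sig ^ 2 + lam ^ 2) < rho ↔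
      (∫⁻ ω, (⨆ t : ℝ≥0, ENNReal.ofReal |Telegraph.reward mu sig rho a y₀ ξ t ω|) ∂P) < ⊤) ∧
    (rho < mu - lam + Real.sqrt (sig ^ 2 + lam ^ 2) ↔
      (⨆ t : ℝ≥0, Telegraph.expectation P (Telegraph.reward mu sig rho a y₀ ξ t)) = ⊤) := by
  have hcrit : mu - lam + Real.sqrt (sig ^ 2 + lam ^ 2) = mu + Telegraph.growth lam sig := by
    rw [Telegraph.growth]
    ring
  rw [hcrit]
  have hsup := hξ.lintegral_iSup_reward_lt_top (a := a) hlam hmu hsig hrho ha hy₀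
  exact ⟨fun h => Telegraph.value_lt_top (hsup h),
    ⟨hsup, hξ.lt_of_lintegral_iSup_reward_lt_top hlam hsig hrho ha hy₀⟩,
    hξ.iSup_expectation_reward_eq_top_iff hlam mu sig hrho ha hy₀⟩
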